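/- Let $G'$ be a finite simple undirected graph, let $e=\{u,v\}$ be an edge of $G'$, and let $G=G'-e$ be the graph obtained by deleting $e$; assume that $G$ (hence also $G'$) is connected. Let $\Gamma$ be the set of spanning trees of $G$ (equivalently, the spanning trees of $G'$ that do not contain $e$), and let $\Gamma'_e$ be the set of spanning trees of $G'$ that contain $e$. Let $R(e)$ be the effective resistance between $u$ and $v$ in $G'$ with unit resistances, i.e. $R(e)=(\delta_u-\delta_v)^{\top}L^{\dagger}(\delta_u-\delta_v)$, where $L^{\dagger}$ is the Moore–Penrose pseudo-inverse of the Laplacian $L=D-A$ of $G'$. A link-cut operation with $e$ on a spanning tree $\tau\not\ni e$ adds $e$ to $\tau$ and then removes one edge other than $e$ of the cycle so created. A cut-link operation with $e$ on a spanning tree $\tau_e\ni e$ removes $e$ from $\tau_e$ and then adds an edge of $G'$ other than $e$ that reconnects the two resulting components. Let $\mathcal B$ be the bipartite graph whose nodes are the spanning trees of $G'$, i.e. the elements of $\Gamma\cup\Gamma'_e$, two of them being adjacent if one can be transformed into the other by a link-cut operation with $e$. Write $N_{\mathcal B}(\tau)$ for the set of neighbours and $d(\tau)=|N_{\mathcal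 B}(\tau)|$ for the degree of $\tau$ in $\mathcal B$, and $U(S)$ for the uniform distribution on a finite non-empty set $S$. Then for every $\tau_e\in\Gamma'_e$ the set $N_{\mathcal B}(\tau_e)$ consists precisely of the trees that result from $\tau_e$ by a cut-link operation with $e$; the sets $\Gamma$, $\Gamma'_e$ and $N_{\mathcal B}(\tau_e)$ for $\tau_e\in\Gamma'_e$ are non-empty, $d(\tau)>0$ for all $\tau\in\Gamma$, and $R(e)<1$; and for every real-valued function $f$ on trees, $$\mathbb E_{\tau\sim U(\Gamma)}[f(\tau)]=\frac{R(e)}{1-R(e)}\;\mathbb E_{\tau_e\sim U(\Gamma'_e)}\left[\mathbb E_{\tau\sim U(N_{\mathcal B}(\tau_e))}\left[f(\tau)\,\frac{d(\tau_e)}{d(\tau)}\right]\right].$$ -/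

import Mathlib

open scoped BigOperators

namespace TreeMaintenance

variable {V : Type*}

open Classical in
/-- The Moore-Penrose pseudo-inverse of the graph Laplacian `L = D - A`, through an orthonormal
eigenbasis: the sum of `σ i⁻¹ • w i * (w i)ᵀ` over the nonzero eigenvalues `σ i` of `L`. -/
noncomputable def lapPseudoInv [Fintype V] (G : SimpleGraph V) : Matrix V V ℝ :=
  let hL : (G.lapMatrix ℝ).IsHermitian := G.isHermitian_lapMatrix ℝ
  ∑ i with hL.eigenvalues i ≠ 0,
    (hL.eigenvalues i)⁻¹ • Matrix.of fun x y => hL.eigenvectorBasis i x * hL.eigenvectorBasis i y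

/-- The effective resistance between `u` and `v` in `G` (every edge being a unit resistor):
`(δ_u - δ_v)ᵀ L† (δ_u - δ_v)`. -/
noncomputable def effectiveResistance [Fintype V] (G : SimpleGraph V) (u v : V) : ℝ :=
  let P := lapPseudoInv G
  P u u - P u v - P v u + P v v

open Classical in
/-- The set of spanning trees of `G`; a spanning tree is a subgraph of `G` on all of `V` which is a
tree. -/
noncomputable def spanningTrees [Fintype V] (G : SimpleGraph V) : Finset (SimpleGraph V) :=
  {τ | τ ≤ G ∧ τ.IsTree}

open Classical in
/-- The set of spanning trees of `G` that contain the edge `e`. -/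
noncomputable def spanningTreesThrough [Fintype V] (G : SimpleGraph V) (e : Sym2 V) :
    Finset (SimpleGraph V) :=
  {τ ∈ spanningTrees G | e ∈ τ.edgeSet}

/-- `τ'` results from `τ` by a link-cut operation with the edge `uv`: the edge `uv`, not in `τ`, is
linked, and one of the other edges `g` of the cycle so created, that is, an edge of the path of `τ`
from `u` to `v`, is cut. -/
def IsLinkCut (u v : V) (τ τ' : SimpleGraph V) : Prop :=
  s(u, v) ∉ τ.edgeSet ∧
    ∃ (p : τ.Walk u v) (g : Sym2 V), p.IsPath ∧ g ∈ p.edges ∧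
      τ' = (τ ⊔ SimpleGraph.fromEdgeSet {s(u, v)}).deleteEdges {g}

/-- `τ'` results from `τ` by a cut-link operation with the edge `e` in the graph `G`: the edge `e`
of `τ` is cut, and another edge `g` of `G` is linked so that the two parts are connected again. -/
def IsCutLink (G : SimpleGraph V) (e : Sym2 V) (τ τ' : SimpleGraph V) : Prop :=
  e ∈ τ.edgeSet ∧
    ∃ g ∈ G.edgeSet, g ≠ e ∧
      τ' = τ.deleteEdges {e} ⊔ SimpleGraph.fromEdgeSet {g} ∧ τ'.Connected

/-- The link-cut graph of `G` with respect to the edge `uv`: its nodes are the spanning trees of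
`G`, and two of them are adjacent if one results from the other by a link-cut operation with `uv`.
(All other elements of `SimpleGraph V` are isolated.) -/
def linkCutGraph [Fintype V] (G : SimpleGraph V) (u v : V) : SimpleGraph (SimpleGraph V) :=
  SimpleGraph.fromRel fun τ τ' =>
    τ ∈ spanningTrees G ∧ τ' ∈ spanningTrees G ∧ IsLinkCut u v τ τ'

open Classical in
/-- The set of neighbours of `τ` in the link-cut graph. -/
noncomputable def linkCutNeighbors [Fintype V] (G : SimpleGraph V) (u v : V) (τ : SimpleGraph V) :
    Finset (SimpleGraph V) :=
  (linkCutGraph G u v).neighborFinset τ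

open Classical in
/-- The degree of `τ` in the link-cut graph. -/
noncomputable def linkCutDegree [Fintype V] (G : SimpleGraph V) (u v : V) (τ : SimpleGraph V) : ℕ :=
  (linkCutGraph G u v).degree τ

end TreeMaintenance

/-!
Kirchhoff: `R(e)` is the proportion of the spanning trees of `G'` that contain `e`, so that
`R(e) / (1 - R(e)) = |Γ'ₑ| / |Γ|`. To see this, let `φ x` be the number of two-component spanning
forests separating `u` from `v` with `x` on the side of `u`. A forest separating two adjacent
vertices `x`, `y` is a spanning tree through `xy` with that edge cut, so `(L φ) x` is a sum over
spanning trees `τ` and edges `xy` of `τ`. Exactly one edge of `τ` at `x` lies on the path from `x`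
to a given `w ≠ x`, whence each `τ` contributes `δ_u - δ_v`. Thus `L φ` is the number of spanning
trees times `δ_u - δ_v`, and `R(e)` is the corresponding multiple of `φ u - φ v`, where `φ v = 0`
and `φ u = |Γ'ₑ|`.

A link-cut operation and its inverse cut-link operation both replace one edge added to a common
two-component forest by another; hence the description of the neighbours. The weights `d(τₑ) / d(τ)`
turn the sum over `τₑ` of averages over neighbours into a sum over the edges of the bipartite graph
in which each edge at `τ ∈ Γ` carries `f(τ) / d(τ)`, so that `τ` contributes `f(τ)` in total.
-/

namespace TreeMaintenance

open SimpleGraph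

section TwoForest

variable {V : Type*} {F G τ : SimpleGraph V} {a b c u v : V}

/-- A forest with exactly two components (isolated vertices count as components): what a tree
becomes when one of its edges is cut. -/
structure IsTwoForest (F : SimpleGraph V) : Prop where
  isAcyclic : F.IsAcyclic
  card_connectedComponent : Nat.card F.ConnectedComponent = 2

open Classical in
/-- The indicator of `F` separating `x` from `w`, in terms of which the currents of Kirchhoff's
potential are expressed. -/
noncomputable def separation (F : SimpleGraph V) (x w : V) : ℝ :=
  if F.Reachable x w then 0 else 1

theorem exists_adj_not_reachable (hG : G.Reachable u v) (hF : ¬F.Reachable u v) :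
    ∃ a b, G.Adj a b ∧ ¬F.Reachable a b := by
  obtain ⟨p⟩ := hG
  obtain ⟨d, -, hfst, hsnd⟩ := p.exists_boundary_dart {z | F.Reachable u z} (Reachable.refl u) hF
  exact ⟨d.fst, d.snd, d.adj, fun h => hsnd (hfst.trans h)⟩

theorem reachable_or_reachable_of_sup_edge (h : (F ⊔ edge a b).Reachable a c) :
    F.Reachable a c ∨ F.Reachable b c := by
  by_contra hc
  obtain ⟨p⟩ := h
  obtain ⟨d, -, hfst, hsnd⟩ := p.exists_boundary_dart
    {z | F.Reachable a z ∨ F.Reachable b z} (Or.inl (Reachable.refl a)) hc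
  refine hsnd ?_
  rcases d.adj with hF | hab
  · exact hfst.imp (·.trans hF.reachable) (·.trans hF.reachable)
  · rcases ((edge_adj ..).1 hab).1 with ⟨-, h⟩ | ⟨-, h⟩ <;> simp [h]

theorem adj_sup_edge (hab : a ≠ b) : (F ⊔ edge a b).Adj a b :=
  Or.inr ((edge_adj ..).2 ⟨Or.inl ⟨rfl, rfl⟩, hab⟩)

theorem not_adj_sup_edge (hF : ¬F.Adj a b) (hne : s(a, b) ≠ s(u, v)) :
    ¬(F ⊔ edge u v).Adj a b := by
  rintro (h | h)
  · exact hF h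
  · exact hne ((adj_edge ..).1 h).1.symm

theorem deleteEdges_sup_edge (hab : τ.Adj a b) : τ.deleteEdges {s(a, b)} ⊔ edge a b = τ :=
  sdiff_sup_cancel ((edge_le_iff _).2 (Or.inr hab))

theorem sup_edge_deleteEdges (hab : ¬F.Adj a b) : (F ⊔ edge a b).deleteEdges {s(a, b)} = F := by
  rw [deleteEdges_sup, deleteEdges_edge (Set.mem_singleton _), sup_bot_eq]
  exact sdiff_edge _ hab

theorem connected_sup_edge_iff (hab : ¬F.Reachable a b) :
    (F ⊔ edge a b).Connected ↔ Nat.card F.ConnectedComponent = 2 := by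
  have hne : a ≠ b := fun h => hab (h ▸ Reachable.refl a)
  rw [Nat.card_eq_two_iff' (F.connectedComponentMk a), connected_iff_exists_forall_reachable]
  constructor
  · rintro ⟨w, hw⟩
    refine ⟨F.connectedComponentMk b, fun h => hab (ConnectedComponent.eq.1 h).symm, ?_⟩
    refine ConnectedComponent.ind fun z hz => ConnectedComponent.eq.2 ?_
    refine ((reachable_or_reachable_of_sup_edge ((hw a).symm.trans (hw z))).resolve_left ?_).symm
    exact fun h => hz (ConnectedComponent.eq.2 h.symm)
  · intro h
    refine ⟨a, fun z => ?_⟩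
    by_cases hz : F.Reachable a z
    · exact hz.mono le_sup_left
    · have hbz : F.Reachable b z := ConnectedComponent.eq.1 <| h.unique
        (fun h => hab (ConnectedComponent.eq.1 h).symm)
        (fun h => hz (ConnectedComponent.eq.1 h).symm)
      exact (adj_sup_edge hne).reachable.trans (hbz.mono le_sup_left)

theorem isTree_sup_edge_iff (hab : ¬F.Reachable a b) :
    (F ⊔ edge a b).IsTree ↔ IsTwoForest F := by
  have hacyclic := isAcyclic_add_edge_iff_of_not_reachable a b hab
  exact ⟨fun h => ⟨hacyclic.1 h.isAcyclic, (connected_sup_edge_iff hab).1 h.connected⟩,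
    fun h => ⟨(connected_sup_edge_iff hab).2 h.card_connectedComponent, hacyclic.2 h.isAcyclic⟩⟩

theorem not_reachable_deleteEdges (hτ : τ.IsAcyclic) (hab : τ.Adj a b) :
    ¬(τ.deleteEdges {s(a, b)}).Reachable a b :=
  isBridge_iff.1 (isAcyclic_iff_forall_adj_isBridge.1 hτ hab)

theorem isTwoForest_deleteEdges (hτ : τ.IsTree) (hab : τ.Adj a b) :
    IsTwoForest (τ.deleteEdges {s(a, b)}) := by
  rw [← isTree_sup_edge_iff (not_reachable_deleteEdges hτ.isAcyclic hab), deleteEdges_sup_edge hab]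
  exact hτ

theorem IsTwoForest.reachable_of_not_reachable (hF : IsTwoForest F) (hab : ¬F.Reachable a b)
    (hbc : ¬F.Reachable b c) : F.Reachable a c :=
  ConnectedComponent.eq.1 <|
    ((Nat.card_eq_two_iff' (F.connectedComponentMk b)).1 hF.card_connectedComponent).unique
      (fun h => hab (ConnectedComponent.eq.1 h)) (fun h => hbc (ConnectedComponent.eq.1 h).symm)

theorem mem_edges_iff_not_reachable_deleteEdges (hτ : τ.IsAcyclic) {p : τ.Walk a b} (hp : p.IsPath)
    {g : Sym2 V} : g ∈ p.edges ↔ ¬(τ.deleteEdges {g}).Reachable a b := by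
  refine ⟨fun hg hab => ?_, p.mem_edges_of_not_reachable_deleteEdges⟩
  obtain ⟨q, hq⟩ := hab.exists_isPath
  have hpq : p = q.mapLe (deleteEdges_le {g}) :=
    congrArg Subtype.val
      ((hτ.subsingleton_path a b).elim ⟨p, hp⟩ ⟨_, hq.mapLe (deleteEdges_le {g})⟩)
  rw [hpq, Walk.edges_mapLe_eq_edges] at hg
  simpa using q.edges_subset_edgeSet hg

theorem existsUnique_adj_not_reachable_deleteEdges (hτ : τ.IsTree) (hab : a ≠ b) :
    ∃! c, τ.Adj a c ∧ ¬(τ.deleteEdges {s(a, c)}).Reachable a b := by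
  obtain ⟨p, hp, -⟩ := hτ.existsUnique_path a b
  simp only [← mem_edges_iff_not_reachable_deleteEdges hτ.isAcyclic hp]
  have hnil : ¬p.Nil := Walk.not_nil_of_ne hab
  exact ⟨p.snd, ⟨p.adj_snd hnil, p.mk_start_snd_mem_edges hnil⟩,
    fun c hc => hp.eq_snd_of_mem_edges hc.2⟩

open Classical in
theorem sum_neighborFinset_separation_deleteEdges (hτ : τ.IsTree) (a b : V)
    [Fintype (τ.neighborSet a)] :
    ∑ c ∈ τ.neighborFinset a, separation (τ.deleteEdges {s(a, c)}) a b =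
      1 - Pi.single (M := fun _ => ℝ) b 1 a := by
  rcases eq_or_ne a b with rfl | hab
  · simp [separation]
  · obtain ⟨c, ⟨hadj, hsep⟩, huniq⟩ := existsUnique_adj_not_reachable_deleteEdges hτ hab
    rw [Finset.sum_eq_single_of_mem c ((τ.mem_neighborFinset a c).2 hadj)]
    · simp [separation, hsep, hab]
    · intro z hz hne
      exact if_pos (not_not.1 fun h => hne (huniq z ⟨(τ.mem_neighborFinset a z).1 hz, h⟩))

end TwoForest

section Exchange

variable {V : Type*} {G τ τ' : SimpleGraph V} {a b u v : V}

/-- `τ'` results from the tree `τ` by exchanging the edge `ab` for `uv`. The forest `F` that the two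
trees share is kept explicit, since it makes link-cut and cut-link operations mirror images. -/
def IsEdgeExchange (a b u v : V) (τ τ' : SimpleGraph V) : Prop :=
  ∃ F, IsTwoForest F ∧ ¬F.Reachable a b ∧ ¬F.Reachable u v ∧ s(a, b) ≠ s(u, v) ∧
    τ = F ⊔ edge a b ∧ τ' = F ⊔ edge u v

namespace IsEdgeExchange

theorem symm (h : IsEdgeExchange a b u v τ τ') : IsEdgeExchange u v a b τ' τ := by
  obtain ⟨F, hF, hab, huv, hne, hτ, hτ'⟩ := h
  exact ⟨F, hF, huv, hab, hne.symm, hτ', hτ⟩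

theorem isTree_right (h : IsEdgeExchange a b u v τ τ') : τ'.IsTree := by
  obtain ⟨F, hF, -, huv, -, -, rfl⟩ := h
  exact (isTree_sup_edge_iff huv).2 hF

theorem adj_right (h : IsEdgeExchange a b u v τ τ') : τ'.Adj u v := by
  obtain ⟨F, -, -, huv, -, -, rfl⟩ := h
  exact adj_sup_edge fun h => huv (h ▸ Reachable.refl u)

theorem le_right (h : IsEdgeExchange a b u v τ τ') (hτ : τ ≤ G) (huv : G.Adj u v) : τ' ≤ G := by
  obtain ⟨F, -, -, -, -, rfl, rfl⟩ := h
  exact sup_le (le_sup_left.trans hτ) ((edge_le_iff _).2 (Or.inr huv))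

end IsEdgeExchange

theorem isLinkCut_iff_exists_isEdgeExchange (hτ : τ.IsTree) :
    IsLinkCut u v τ τ' ↔ ∃ a b, IsEdgeExchange a b u v τ τ' := by
  have cut_link {F : SimpleGraph V} {a b : V} (hab : ¬F.Adj a b) (hne : s(a, b) ≠ s(u, v)) :
      (F ⊔ edge a b ⊔ edge u v).deleteEdges {s(a, b)} = F ⊔ edge u v := by
    rw [sup_right_comm, sup_edge_deleteEdges (not_adj_sup_edge hab hne)]
  constructor
  · rintro ⟨huv, p, ⟨a, b⟩, hp, hg, rfl⟩
    have hab : τ.Adj a b := p.edges_subset_edgeSet hg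
    have hne : s(a, b) ≠ s(u, v) := fun h => huv (h ▸ hab)
    refine ⟨a, b, τ.deleteEdges {s(a, b)}, isTwoForest_deleteEdges hτ hab,
      not_reachable_deleteEdges hτ.isAcyclic hab,
      (mem_edges_iff_not_reachable_deleteEdges hτ.isAcyclic hp).1 hg, hne,
      (deleteEdges_sup_edge hab).symm, ?_⟩
    rw [← cut_link (by simp) hne, deleteEdges_sup_edge hab]
    rfl
  · rintro ⟨a, b, F, -, hab, huv, hne, rfl, rfl⟩
    have hFab : ¬F.Adj a b := fun h => hab h.reachable
    obtain ⟨p, hp, -⟩ := hτ.existsUnique_path u v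
    refine ⟨not_adj_sup_edge (fun h => huv h.reachable) hne.symm, p, s(a, b), hp, ?_,
      (cut_link hFab hne).symm⟩
    rwa [mem_edges_iff_not_reachable_deleteEdges hτ.isAcyclic hp, sup_edge_deleteEdges hFab]

theorem isCutLink_iff_exists_isEdgeExchange (hτ' : τ'.IsTree) :
    IsCutLink G s(u, v) τ' τ ↔ ∃ a b, G.Adj a b ∧ IsEdgeExchange a b u v τ τ' := by
  constructor
  · rintro ⟨huv, ⟨a, b⟩, hab, hne, rfl, hconn⟩
    have huv' := not_reachable_deleteEdges hτ'.isAcyclic huv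
    refine ⟨a, b, hab, _, isTwoForest_deleteEdges hτ' huv, fun hr => huv' ?_, huv', hne, rfl,
      (deleteEdges_sup_edge huv).symm⟩
    have hreach (z : V) : (τ'.deleteEdges {s(u, v)}).Reachable a z :=
      (reachable_or_reachable_of_sup_edge (hconn.preconnected a z)).elim id hr.trans
    exact (hreach u).symm.trans (hreach v)
  · rintro ⟨a, b, hab, h⟩
    have hconn := h.symm.isTree_right.connected
    have huv := h.adj_right
    obtain ⟨F, -, -, hFuv, hne, rfl, rfl⟩ := h
    refine ⟨huv, s(a, b), hab, hne, ?_, hconn⟩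
    rw [sup_edge_deleteEdges fun h => hFuv h.reachable]
    rfl

end Exchange

section Kirchhoff

open scoped Matrix

variable {V : Type*} [Fintype V] {F G τ : SimpleGraph V} {u v x y : V}

theorem mem_spanningTrees : τ ∈ spanningTrees G ↔ τ ≤ G ∧ τ.IsTree := by
  simp [spanningTrees]

theorem mem_spanningTreesThrough :
    τ ∈ spanningTreesThrough G s(u, v) ↔ τ ∈ spanningTrees G ∧ τ.Adj u v := by
  simp [spanningTreesThrough]

theorem mem_spanningTrees_deleteEdges :
    τ ∈ spanningTrees (G.deleteEdges {s(u, v)}) ↔ τ ∈ spanningTrees G ∧ ¬τ.Adj u v := by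
  rw [mem_spanningTrees, mem_spanningTrees, deleteEdges, le_sdiff, disjoint_fromEdgeSet,
    Set.disjoint_singleton_right, mem_edgeSet]
  tauto

theorem spanningTrees_nonempty (hG : G.Connected) : (spanningTrees G).Nonempty :=
  let ⟨τ, hle, hτ⟩ := hG.exists_isTree_le
  ⟨τ, mem_spanningTrees.2 ⟨hle, hτ⟩⟩

theorem spanningTreesThrough_nonempty (huv : G.Adj u v) (hG : G.Connected) :
    (spanningTreesThrough G s(u, v)).Nonempty := by
  have hbot : ¬(⊥ : SimpleGraph V).Reachable u v := by simpa using huv.ne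
  obtain ⟨τ, hedge, hle, hτ⟩ := hG.exists_isTree_le_of_le_of_isAcyclic
    ((edge_le_iff _).2 (Or.inr huv))
    (by simpa using (isAcyclic_add_edge_iff_of_not_reachable u v hbot).2 isAcyclic_bot)
  exact ⟨τ, mem_spanningTreesThrough.2
    ⟨mem_spanningTrees.2 ⟨hle, hτ⟩, ((edge_le_iff _).1 hedge).resolve_left huv.ne⟩⟩

open Classical in
theorem card_spanningTrees_deleteEdges_add (G : SimpleGraph V) (u v : V) :
    (spanningTrees (G.deleteEdges {s(u, v)})).card + (spanningTreesThrough G s(u, v)).card =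
      (spanningTrees G).card := by
  rw [← Finset.card_filter_add_card_filter_not (s := spanningTrees G) (fun τ => ¬τ.Adj u v)]
  congr 2 <;> ext τ <;> simp [mem_spanningTrees_deleteEdges, mem_spanningTreesThrough]

open Classical in
/-- The spanning forests of `G` with exactly two components. -/
noncomputable def twoForests (G : SimpleGraph V) : Finset (SimpleGraph V) :=
  {F | F ≤ G ∧ IsTwoForest F}

theorem mem_twoForests : F ∈ twoForests G ↔ F ≤ G ∧ IsTwoForest F := by
  simp [twoForests]

open Classical in
theorem sum_twoForests_not_reachable {M : Type*} [AddCommMonoid M] (hxy : G.Adj x y)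
    (g : SimpleGraph V → M) :
    ∑ F ∈ twoForests G with ¬F.Reachable x y, g F =
      ∑ τ ∈ spanningTreesThrough G s(x, y), g (τ.deleteEdges {s(x, y)}) := by
  refine Finset.sum_nbij' (· ⊔ edge x y) (·.deleteEdges {s(x, y)}) ?_ ?_ ?_ ?_ ?_ <;>
    simp only [Finset.mem_filter, mem_twoForests, mem_spanningTreesThrough, mem_spanningTrees,
      and_imp]
  · exact fun F hle hF hr => ⟨⟨sup_le hle ((edge_le_iff _).2 (Or.inr hxy)),
      (isTree_sup_edge_iff hr).2 hF⟩, adj_sup_edge hxy.ne⟩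
  · exact fun τ hle hτ hadj => ⟨⟨(deleteEdges_le _).trans hle, isTwoForest_deleteEdges hτ hadj⟩,
      not_reachable_deleteEdges hτ.isAcyclic hadj⟩
  · exact fun F _ _ hr => sup_edge_deleteEdges fun h => hr h.reachable
  · exact fun τ _ _ hadj => deleteEdges_sup_edge hadj
  · exact fun F _ _ hr => by rw [sup_edge_deleteEdges fun h => hr h.reachable]

open Classical in
/-- Kirchhoff's potential: the number of two-component spanning forests of `G` that separate `u`
from `v` and have `x` on the side of `u`. It is the potential of a current from `u` to `v` whose
strength is the number of spanning trees. -/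
noncomputable def forestPotential (G : SimpleGraph V) (u v x : V) : ℝ :=
  ({F ∈ twoForests G | ¬F.Reachable u v ∧ F.Reachable u x} : Finset _).card

theorem forestPotential_sink (G : SimpleGraph V) (u v : V) : forestPotential G u v v = 0 := by
  simp [forestPotential]

theorem forestPotential_source (huv : G.Adj u v) :
    forestPotential G u v u = (spanningTreesThrough G s(u, v)).card := by
  rw [Finset.card_eq_sum_ones, ← sum_twoForests_not_reachable huv fun _ => 1,
    ← Finset.card_eq_sum_ones, forestPotential]
  congr! 3 with F
  exact and_iff_left (Reachable.refl u)

open Classical in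
theorem forestPotential_sub_forestPotential (G : SimpleGraph V) (u v x y : V) :
    forestPotential G u v x - forestPotential G u v y =
      ∑ F ∈ twoForests G with ¬F.Reachable x y, (separation F x v - separation F x u) := by
  simp only [forestPotential, separation, Finset.natCast_card_filter, Finset.sum_filter,
    ← Finset.sum_sub_distrib]
  refine Finset.sum_congr rfl fun F hF => ?_
  -- Reachability in `F` is an equivalence relation with two classes: finitely many cases remain.
  have htwo {a b c : V} : ¬F.Reachable a b → ¬F.Reachable b c → F.Reachable a c :=
    (mem_twoForests.1 hF).2.reachable_of_not_reachable
  have htrans {a b c : V} : F.Reachable a b → F.Reachable b c → F.Reachable a c := Reachable.trans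
  have hsymm {a b : V} : F.Reachable a b → F.Reachable b a := Reachable.symm
  grind

open Classical in
theorem lapMatrix_mulVec_forestPotential (G : SimpleGraph V) (u v : V) :
    G.lapMatrix ℝ *ᵥ forestPotential G u v =
      ((spanningTrees G).card : ℝ) • (Pi.single u 1 - Pi.single v 1) := by
  ext x
  let flow (F : SimpleGraph V) : ℝ := separation F x v - separation F x u
  calc (G.lapMatrix ℝ *ᵥ forestPotential G u v) x
      = ∑ y ∈ G.neighborFinset x, (forestPotential G u v x - forestPotential G u v y) := by
        rw [lapMatrix_mulVec_apply]
        simp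
    _ = ∑ y ∈ G.neighborFinset x, ∑ τ ∈ spanningTreesThrough G s(x, y),
          flow (τ.deleteEdges {s(x, y)}) := by
        refine Finset.sum_congr rfl fun y hy => ?_
        rw [forestPotential_sub_forestPotential,
          sum_twoForests_not_reachable ((G.mem_neighborFinset x y).1 hy)]
    _ = ∑ τ ∈ spanningTrees G, ∑ y ∈ τ.neighborFinset x, flow (τ.deleteEdges {s(x, y)}) := by
        refine Finset.sum_comm' fun y τ => ?_
        simp only [mem_neighborFinset, mem_spanningTreesThrough]
        exact ⟨fun h => h.2.symm, fun h => ⟨(mem_spanningTrees.1 h.2).1 h.1, h.symm⟩⟩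
    _ = ∑ _ ∈ spanningTrees G, (Pi.single u 1 - Pi.single v 1 : V → ℝ) x := by
        refine Finset.sum_congr rfl fun τ hτ => ?_
        have hτ := (mem_spanningTrees.1 hτ).2
        rw [Finset.sum_sub_distrib, sum_neighborFinset_separation_deleteEdges hτ,
          sum_neighborFinset_separation_deleteEdges hτ, Pi.sub_apply]
        ring
    _ = _ := by rw [Finset.sum_const, nsmul_eq_mul, Pi.smul_apply, smul_eq_mul]

end Kirchhoff

section Resistance

open Matrix

variable {V : Type*} [Fintype V] {G : SimpleGraph V} {u v : V}

open Classical in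
theorem lapPseudoInv_eq_eigenvectorUnitary_mul (G : SimpleGraph V) :
    let hL := G.isHermitian_lapMatrix ℝ
    lapPseudoInv G = (hL.eigenvectorUnitary : Matrix V V ℝ) *
      diagonal hL.eigenvalues⁻¹ * star (hL.eigenvectorUnitary : Matrix V V ℝ) := by
  intro hL
  ext x y
  rw [lapPseudoInv, Matrix.sum_apply, Matrix.mul_apply, Finset.sum_filter]
  simp only [Matrix.smul_apply, of_apply, smul_eq_mul, mul_diagonal, star_apply,
    IsHermitian.eigenvectorUnitary_apply, Pi.inv_apply, star_trivial]
  refine Finset.sum_congr rfl fun i _ => ?_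
  split_ifs with h
  · ring
  · simp [not_not.1 h]

open Classical in
theorem lapMatrix_mul_lapPseudoInv_mul_lapMatrix (G : SimpleGraph V) :
    G.lapMatrix ℝ * lapPseudoInv G * G.lapMatrix ℝ = G.lapMatrix ℝ := by
  have hL := G.isHermitian_lapMatrix ℝ
  set U : Matrix V V ℝ := (hL.eigenvectorUnitary : Matrix V V ℝ)
  set σ := hL.eigenvalues
  have hUU : star U * U = 1 := Unitary.coe_star_mul_self hL.eigenvectorUnitary
  have hspec : G.lapMatrix ℝ = U * diagonal σ * star U := by
    simpa [Unitary.conjStarAlgAut_apply] using hL.spectral_theorem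
  have hpinv : lapPseudoInv G = U * diagonal σ⁻¹ * star U :=
    lapPseudoInv_eq_eigenvectorUnitary_mul G
  have hdiag : diagonal σ * diagonal σ⁻¹ * diagonal σ = diagonal σ := by
    simp [diagonal_mul_diagonal, mul_inv_mul_cancel]
  calc G.lapMatrix ℝ * lapPseudoInv G * G.lapMatrix ℝ
      = U * diagonal σ * (star U * U) * diagonal σ⁻¹ * (star U * U) * diagonal σ * star U := by
        rw [hpinv]
        nth_rw 1 2 [hspec]
        simp only [Matrix.mul_assoc]
    _ = U * (diagonal σ * diagonal σ⁻¹ * diagonal σ) * star U := by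
        simp only [hUU, Matrix.mul_one, Matrix.mul_assoc]
    _ = G.lapMatrix ℝ := by rw [hdiag, hspec]

open Classical in
theorem effectiveResistance_eq_dotProduct (G : SimpleGraph V) (u v : V) :
    effectiveResistance G u v =
      (Pi.single u 1 - Pi.single v 1) ⬝ᵥ lapPseudoInv G *ᵥ (Pi.single u 1 - Pi.single v 1) := by
  simp only [effectiveResistance, mulVec_sub, sub_dotProduct, dotProduct_sub,
    single_one_dotProduct, mulVec_single_one, Matrix.col_apply]
  ring

open Classical in
theorem effectiveResistance_eq_sub_of_lapMatrix_mulVec {φ : V → ℝ}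
    (hφ : G.lapMatrix ℝ *ᵥ φ = Pi.single u 1 - Pi.single v 1) :
    effectiveResistance G u v = φ u - φ v := by
  have hsymm (ψ : V → ℝ) : (G.lapMatrix ℝ *ᵥ φ) ⬝ᵥ ψ = φ ⬝ᵥ G.lapMatrix ℝ *ᵥ ψ := by
    rw [dotProduct_mulVec, ← mulVec_transpose, (G.isSymm_lapMatrix (R := ℝ)).eq]
  calc effectiveResistance G u v
      = (G.lapMatrix ℝ *ᵥ φ) ⬝ᵥ lapPseudoInv G *ᵥ G.lapMatrix ℝ *ᵥ φ := by
        rw [effectiveResistance_eq_dotProduct, hφ]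
    _ = φ ⬝ᵥ G.lapMatrix ℝ *ᵥ φ := by
        rw [hsymm, mulVec_mulVec, mulVec_mulVec, lapMatrix_mul_lapPseudoInv_mul_lapMatrix]
    _ = φ u - φ v := by
        rw [hφ, dotProduct_sub, dotProduct_single_one, dotProduct_single_one]

theorem effectiveResistance_eq_card_div_card (huv : G.Adj u v) (hG : G.Connected) :
    effectiveResistance G u v = (spanningTreesThrough G s(u, v)).card / (spanningTrees G).card := by
  classical
  have hT : ((spanningTrees G).card : ℝ) ≠ 0 := by
    exact_mod_cast (spanningTrees_nonempty hG).card_ne_zero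
  have hφ : G.lapMatrix ℝ *ᵥ (((spanningTrees G).card : ℝ)⁻¹ • forestPotential G u v) =
      Pi.single u 1 - Pi.single v 1 := by
    rw [mulVec_smul, lapMatrix_mulVec_forestPotential, inv_smul_smul₀ hT]
  rw [effectiveResistance_eq_sub_of_lapMatrix_mulVec hφ, Pi.smul_apply, Pi.smul_apply,
    forestPotential_source huv, forestPotential_sink, smul_zero, sub_zero, smul_eq_mul,
    inv_mul_eq_div]

theorem one_sub_effectiveResistance (huv : G.Adj u v) (hG : G.Connected) :
    1 - effectiveResistance G u v =
      (spanningTrees (G.deleteEdges {s(u, v)})).card / (spanningTrees G).card := by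
  have hT : ((spanningTrees G).card : ℝ) ≠ 0 := by
    exact_mod_cast (spanningTrees_nonempty hG).card_ne_zero
  rw [effectiveResistance_eq_card_div_card huv hG, eq_div_iff hT, sub_mul, div_mul_cancel₀ _ hT,
    ← card_spanningTrees_deleteEdges_add G u v]
  push_cast
  ring

theorem effectiveResistance_lt_one (huv : G.Adj u v)
    (hG : (G.deleteEdges {s(u, v)}).Connected) : effectiveResistance G u v < 1 := by
  have hconn := hG.mono (deleteEdges_le _)
  rw [← sub_pos, one_sub_effectiveResistance huv hconn]
  have hΓ := (spanningTrees_nonempty hG).card_pos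
  have hT := (spanningTrees_nonempty hconn).card_pos
  positivity

theorem effectiveResistance_div_one_sub_effectiveResistance (huv : G.Adj u v) (hG : G.Connected) :
    effectiveResistance G u v / (1 - effectiveResistance G u v) =
      (spanningTreesThrough G s(u, v)).card / (spanningTrees (G.deleteEdges {s(u, v)})).card := by
  have hT : ((spanningTrees G).card : ℝ) ≠ 0 := by
    exact_mod_cast (spanningTrees_nonempty hG).card_ne_zero
  rw [one_sub_effectiveResistance huv hG, effectiveResistance_eq_card_div_card huv hG,
    div_div_div_cancel_right₀ hT]

end Resistance

section DoubleCounting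

theorem sum_expect_neighborFinset_mul_degree_div_degree {W K : Type*} [Semifield K] [CharZero K]
    {H : SimpleGraph W} [H.LocallyFinite] {s t : Finset W} (hH : H.IsBipartiteWith s t)
    (ht : ∀ b ∈ t, 0 < H.degree b) (f : W → K) :
    ∑ a ∈ s, 𝔼 b ∈ H.neighborFinset a, f b * (H.degree a / H.degree b) = ∑ b ∈ t, f b := by
  have cancel (a b : W) (hab : b ∈ H.neighborFinset a) :
      f b * (H.degree a / H.degree b) / H.degree a = f b / H.degree b := by
    have ha : (H.degree a : K) ≠ 0 := by
      exact_mod_cast Finset.card_ne_zero_of_mem hab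
    field_simp
  calc ∑ a ∈ s, 𝔼 b ∈ H.neighborFinset a, f b * (H.degree a / H.degree b)
      = ∑ a ∈ s, ∑ b ∈ H.neighborFinset a, f b / H.degree b := by
        simp only [Finset.expect_eq_sum_div_card, card_neighborFinset_eq_degree, Finset.sum_div]
        exact Finset.sum_congr rfl fun a _ => Finset.sum_congr rfl (cancel a)
    _ = ∑ b ∈ t, ∑ _ ∈ H.neighborFinset b, f b / H.degree b := by
        refine Finset.sum_comm' fun a b => ?_
        simp only [mem_neighborFinset]
        exact ⟨fun h => ⟨h.2.symm, hH.mem_of_mem_adj h.1 h.2⟩,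
          fun h => ⟨hH.symm.mem_of_mem_adj h.2 h.1, h.1.symm⟩⟩
    _ = ∑ b ∈ t, f b := by
        refine Finset.sum_congr rfl fun b hb => ?_
        rw [Finset.sum_const, card_neighborFinset_eq_degree, nsmul_eq_mul, mul_div_cancel₀]
        exact_mod_cast (ht b hb).ne'

end DoubleCounting

section LinkCutGraph

variable {V : Type*} [Fintype V] {G τ τe : SimpleGraph V} {u v : V}

theorem mem_linkCutNeighbors {σ : SimpleGraph V} :
    τ ∈ linkCutNeighbors G u v σ ↔ (linkCutGraph G u v).Adj σ τ := by
  simp [linkCutNeighbors]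

theorem linkCutGraph_adj_iff (hτe : τe ∈ spanningTreesThrough G s(u, v)) :
    (linkCutGraph G u v).Adj τe τ ↔ τ ∈ spanningTrees G ∧ IsLinkCut u v τ τe := by
  obtain ⟨hτe, huv⟩ := mem_spanningTreesThrough.1 hτe
  rw [linkCutGraph, fromRel_adj]
  constructor
  · rintro ⟨-, ⟨-, -, h⟩ | ⟨hτ, -, h⟩⟩
    · exact absurd huv h.1
    · exact ⟨hτ, h⟩
  · exact fun ⟨hτ, h⟩ => ⟨fun heq => h.1 (heq ▸ huv), Or.inr ⟨hτ, hτe, h⟩⟩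

theorem linkCutGraph_isBipartiteWith (G : SimpleGraph V) (u v : V) :
    (linkCutGraph G u v).IsBipartiteWith (spanningTreesThrough G s(u, v))
      (spanningTrees (G.deleteEdges {s(u, v)})) where
  disjoint := Set.disjoint_left.2 fun _ hτe hτ =>
    (mem_spanningTrees_deleteEdges.1 hτ).2 (mem_spanningTreesThrough.1 hτe).2
  mem_of_adj := by
    have cross {τ τe : SimpleGraph V} (hτ : τ ∈ spanningTrees G) (hτe : τe ∈ spanningTrees G)
        (h : IsLinkCut u v τ τe) : τe ∈ spanningTreesThrough G s(u, v) ∧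
          τ ∈ spanningTrees (G.deleteEdges {s(u, v)}) := by
      obtain ⟨a, b, hex⟩ :=
        (isLinkCut_iff_exists_isEdgeExchange (mem_spanningTrees.1 hτ).2).1 h
      exact ⟨mem_spanningTreesThrough.2 ⟨hτe, hex.adj_right⟩,
        mem_spanningTrees_deleteEdges.2 ⟨hτ, h.1⟩⟩
    rintro σ σ' ⟨-, ⟨hσ, hσ', h⟩ | ⟨hσ', hσ, h⟩⟩
    · exact Or.inr (cross hσ hσ' h).symm
    · exact Or.inl (cross hσ' hσ h)

theorem mem_linkCutNeighbors_iff_isCutLink (hτe : τe ∈ spanningTreesThrough G s(u, v)) :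
    τ ∈ linkCutNeighbors G u v τe ↔ IsCutLink G s(u, v) τe τ := by
  obtain ⟨hle, htree⟩ := mem_spanningTrees.1 (mem_spanningTreesThrough.1 hτe).1
  rw [mem_linkCutNeighbors, linkCutGraph_adj_iff hτe, isCutLink_iff_exists_isEdgeExchange htree]
  constructor
  · rintro ⟨hτ, h⟩
    obtain ⟨hτle, hτtree⟩ := mem_spanningTrees.1 hτ
    obtain ⟨a, b, hex⟩ := (isLinkCut_iff_exists_isEdgeExchange hτtree).1 h
    exact ⟨a, b, hτle hex.symm.adj_right, hex⟩
  · rintro ⟨a, b, hab, hex⟩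
    have hτtree := hex.symm.isTree_right
    exact ⟨mem_spanningTrees.2 ⟨hex.symm.le_right hle hab, hτtree⟩,
      (isLinkCut_iff_exists_isEdgeExchange hτtree).2 ⟨a, b, hex⟩⟩

theorem linkCutNeighbors_nonempty (hG : (G.deleteEdges {s(u, v)}).Connected)
    (hτe : τe ∈ spanningTreesThrough G s(u, v)) : (linkCutNeighbors G u v τe).Nonempty := by
  obtain ⟨hτ, huv⟩ := mem_spanningTreesThrough.1 hτe
  have htree := (mem_spanningTrees.1 hτ).2
  have hsep := not_reachable_deleteEdges htree.isAcyclic huv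
  obtain ⟨a, b, hab, hFab⟩ := exists_adj_not_reachable (hG.preconnected u v) hsep
  obtain ⟨hGab, hne⟩ := (deleteEdges_adj ..).1 hab
  exact ⟨_, (mem_linkCutNeighbors_iff_isCutLink hτe).2 <|
    (isCutLink_iff_exists_isEdgeExchange htree).2 ⟨a, b, hGab, _,
      isTwoForest_deleteEdges htree huv, hFab, hsep, hne, rfl, (deleteEdges_sup_edge huv).symm⟩⟩

theorem linkCutDegree_pos (huv : G.Adj u v)
    (hτ : τ ∈ spanningTrees (G.deleteEdges {s(u, v)})) : 0 < linkCutDegree G u v τ := by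
  obtain ⟨hτ, hτuv⟩ := mem_spanningTrees_deleteEdges.1 hτ
  obtain ⟨hle, htree⟩ := mem_spanningTrees.1 hτ
  obtain ⟨c, ⟨hadj, hsep⟩, -⟩ := existsUnique_adj_not_reachable_deleteEdges htree huv.ne
  have hex : IsEdgeExchange u c u v τ (τ.deleteEdges {s(u, c)} ⊔ edge u v) :=
    ⟨_, isTwoForest_deleteEdges htree hadj, not_reachable_deleteEdges htree.isAcyclic hadj, hsep,
      fun h => hτuv (h ▸ hadj : s(u, v) ∈ τ.edgeSet), (deleteEdges_sup_edge hadj).symm, rfl⟩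
  have hτe := mem_spanningTreesThrough.2
    ⟨mem_spanningTrees.2 ⟨hex.le_right hle huv, hex.isTree_right⟩, hex.adj_right⟩
  classical
  refine (degree_pos_iff_exists_adj ..).2 ⟨_, ((linkCutGraph_adj_iff hτe).2 ⟨hτ, ?_⟩).symm⟩
  exact (isLinkCut_iff_exists_isEdgeExchange htree).2 ⟨u, c, hex⟩

end LinkCutGraph

end TreeMaintenance

theorem mainTheorem8 {V : Type*} [Fintype V] (G' : SimpleGraph V) (u v : V)
    (he : G'.Adj u v) (hG : (G'.deleteEdges {s(u, v)}).Connected) (f : SimpleGraph V → ℝ) :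
    let Γ := TreeMaintenance.spanningTrees (G'.deleteEdges {s(u, v)})
    let Γe := TreeMaintenance.spanningTreesThrough G' s(u, v)
    let R := TreeMaintenance.effectiveResistance G' u v
    let N := TreeMaintenance.linkCutNeighbors G' u v
    let d := TreeMaintenance.linkCutDegree G' u v
    (∀ τe ∈ Γe, ∀ τ, τ ∈ N τe ↔ TreeMaintenance.IsCutLink G' s(u, v) τe τ) ∧
    Γ.Nonempty ∧ Γe.Nonempty ∧ (∀ τe ∈ Γe, (N τe).Nonempty) ∧ (∀ τ ∈ Γ, 0 < d τ) ∧ R < 1 ∧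
    𝔼 τ ∈ Γ, f τ =
      R / (1 - R) * 𝔼 τe ∈ Γe, 𝔼 τ ∈ N τe, (f τ * ((d τe : ℝ) / (d τ : ℝ))) := by
  classical
  intro Γ Γe R N d
  have hconn : G'.Connected := hG.mono (SimpleGraph.deleteEdges_le _)
  have hΓ : Γ.Nonempty := TreeMaintenance.spanningTrees_nonempty hG
  have hΓe : Γe.Nonempty := TreeMaintenance.spanningTreesThrough_nonempty he hconn
  have hd : ∀ τ ∈ Γ, 0 < d τ := fun τ => TreeMaintenance.linkCutDegree_pos he
  have hodds : R / (1 - R) = Γe.card / Γ.card :=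
    TreeMaintenance.effectiveResistance_div_one_sub_effectiveResistance he hconn
  have hcount : ∑ τe ∈ Γe, 𝔼 τ ∈ N τe, f τ * ((d τe : ℝ) / d τ) = ∑ τ ∈ Γ, f τ :=
    TreeMaintenance.sum_expect_neighborFinset_mul_degree_div_degree
      (TreeMaintenance.linkCutGraph_isBipartiteWith G' u v) hd f
  refine ⟨fun τe hτe τ => TreeMaintenance.mem_linkCutNeighbors_iff_isCutLink hτe, hΓ, hΓe,
    fun τe => TreeMaintenance.linkCutNeighbors_nonempty hG, hd,
    TreeMaintenance.effectiveResistance_lt_one he hG, ?_⟩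
  rw [hodds, Finset.expect_eq_sum_div_card, Finset.expect_eq_sum_div_card, hcount]
  field [hΓ.card_ne_zero, hΓe.card_ne_zero]
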